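/- Let $D\ge 1$, and let $\mathcal H_A,\mathcal H_B,\mathcal H_a,\mathcal H_b$ be $D$-dimensional complex Hilbert spaces; Alice holds $A,a$ and Bob holds $B,b$. A unit vector $|\psi\rangle\in\mathcal H_A\otimes\mathcal H_B$ is maximally entangled if $|\psi\rangle=D^{-1/2}\sum_{r}|u_r\rangle|v_r\rangle$ for some orthonormal bases $\{|u_r\rangle\}$ of $\mathcal H_A$ and $\{|v_r\rangle\}$ of $\mathcal H_B$. A set $\mathcal S$ of states in $\mathcal H_A\otimes\mathcal H_B$ can be cloned by LOCC if there are a unit vector (blank state) $|\phi\rangle\in\mathcal H_a\otimes\mathcal H_b$ and an operation $\Lambda$, implemented by a finite protocol of local operations of Alice (on $Aa$) and of Bob (on $Bb$) and classical communication, such that, with $\mathcal H_a,\mathcal H_b$ identified with $\mathcal H_A,\mathcal H_B$, $$\Lambda\big(|\psi\rangle\langle\psi|^{AB}\otimes|\phi\rangle\langle\phi|^{ab}\big)=|\psi\rangle\langle\psi|^{AB}\otimes|\psi\rangle\langle\psi|^{ab}\qquad\text{for all }|\psi\rangle\in\mathcal S .$$ Theorem (Maximally entangled states). Let $\mathcal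 S$ be a set of maximally entangled states on $\mathcal H_A\otimes\mathcal H_B$. Then $\mathcal S$ can be cloned by LOCC if and only if there are a finite group $G$ of order $D$ and orthonormal bases $\{|g\rangle^A\}_{g\in G}$ of $\mathcal H_A$ and $\{|g\rangle^B\}_{g\in G}$ of $\mathcal H_B$ such that every state of $\mathcal S$ equals, up to a global phase, $$|\psi_f\rangle=\frac1{\sqrt D}\sum_{g\in G}|fg\rangle^A|g\rangle^B\qquad\text{for some } f\in G .$$ Likewise, $\mathcal S$ can be cloned by LOCC if and only if there are such $G$ and bases for which every state of $\mathcal S$ equals, up to a global phase, $\frac1{\sqrt D}\sum_{g\in G}|g\rangle^A|fg\rangle^B$ for some $f\in G$. -/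

import Mathlib

open scoped Kronecker Matrix

noncomputable section

/-- The tensor product `x ⊗ y` of two vectors, as a vector on the product index set. -/
def tensorVec {ι κ : Type} (x : EuclideanSpace ℂ ι) (y : EuclideanSpace ℂ κ) :
    EuclideanSpace ℂ (ι × κ) :=
  WithLp.toLp 2 fun p => x p.1 * y p.2

/-- The rank-one operator `|x⟩⟨x|`. -/
def ketBra {ι : Type} (x : EuclideanSpace ℂ ι) : Matrix ι ι ℂ :=
  Matrix.of fun i j => x i * star (x j)

/-- The state `ψ^{AB} ⊗ φ^{ab}` of Alice's pair of systems `A, a` and Bob's pair `B, b`, with the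
tensor factors regrouped across the Alice/Bob cut `Aa | Bb`. -/
def twoPairs {A B a b : Type} (ψ : EuclideanSpace ℂ (A × B)) (φ : EuclideanSpace ℂ (a × b)) :
    EuclideanSpace ℂ ((A × a) × (B × b)) :=
  WithLp.toLp 2 fun p => ψ (p.1.1, p.2.1) * φ (p.1.2, p.2.2)

/-- `IsLOCC α' β' α β Λ`: the map `Λ` on operators, from a bipartite system with local spaces
`ℂ^α` (Alice), `ℂ^β` (Bob) to one with local spaces `ℂ^α'`, `ℂ^β'`, is implemented by a finite
protocol of local operations and classical communication.  Either the protocol ends; or one party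
performs a generalized measurement on the local system (Kraus operators `K k`, with
`∑ k, (K k)ᴴ * K k = 1`; the local space after outcome `k` is any `ℂ^(γ k)`, so that ancillas may
be adjoined or discarded), announces the outcome `k`, and the two parties continue with an LOCC
protocol `Λ k` that may depend on `k`.  Outcomes are averaged over in the end. -/
inductive IsLOCC (α' β' : Type) [Fintype α'] [DecidableEq α'] [Fintype β'] [DecidableEq β'] :
    ∀ (α β : Type) [Fintype α] [DecidableEq α] [Fintype β] [DecidableEq β],
      (Matrix (α × β) (α × β) ℂ → Matrix (α' × β') (α' × β') ℂ) → Prop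
  | finish : IsLOCC α' β' α' β' fun ρ => ρ
  | alice (α β : Type) [Fintype α] [DecidableEq α] [Fintype β] [DecidableEq β]
      (n : ℕ) (γ : Fin n → Type) [∀ k, Fintype (γ k)] [∀ k, DecidableEq (γ k)]
      (K : ∀ k, Matrix (γ k) α ℂ) (hK : ∑ k, (K k)ᴴ * K k = 1)
      (Λ : ∀ k, Matrix (γ k × β) (γ k × β) ℂ → Matrix (α' × β') (α' × β') ℂ)
      (hΛ : ∀ k, IsLOCC α' β' (γ k) β (Λ k)) :
      IsLOCC α' β' α β fun ρ =>
        ∑ k, Λ k ((K k ⊗ₖ (1 : Matrix β β ℂ)) * ρ * (K k ⊗ₖ (1 : Matrix β β ℂ))ᴴ)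
  | bob (α β : Type) [Fintype α] [DecidableEq α] [Fintype β] [DecidableEq β]
      (n : ℕ) (γ : Fin n → Type) [∀ k, Fintype (γ k)] [∀ k, DecidableEq (γ k)]
      (K : ∀ k, Matrix (γ k) β ℂ) (hK : ∑ k, (K k)ᴴ * K k = 1)
      (Λ : ∀ k, Matrix (α × γ k) (α × γ k) ℂ → Matrix (α' × β') (α' × β') ℂ)
      (hΛ : ∀ k, IsLOCC α' β' α (γ k) (Λ k)) :
      IsLOCC α' β' α β fun ρ =>
        ∑ k, Λ k (((1 : Matrix α α ℂ) ⊗ₖ K k) * ρ * ((1 : Matrix α α ℂ) ⊗ₖ K k)ᴴ)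

/-- A set `S` of states on a `D × D` system can be cloned by LOCC: with some `D × D` blank state
`φ` shared in advance, a single LOCC operation maps `ψ^{AB} ⊗ φ^{ab}` to `ψ^{AB} ⊗ ψ^{ab}`
deterministically, for every `ψ ∈ S`. -/
def CanBeClonedByLOCC {D : ℕ} (S : Set (EuclideanSpace ℂ (Fin D × Fin D))) : Prop :=
  ∃ φ : EuclideanSpace ℂ (Fin D × Fin D), ‖φ‖ = 1 ∧
    ∃ Λ : Matrix ((Fin D × Fin D) × (Fin D × Fin D)) ((Fin D × Fin D) × (Fin D × Fin D)) ℂ →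
        Matrix ((Fin D × Fin D) × (Fin D × Fin D)) ((Fin D × Fin D) × (Fin D × Fin D)) ℂ,
      IsLOCC (Fin D × Fin D) (Fin D × Fin D) (Fin D × Fin D) (Fin D × Fin D) Λ ∧
        ∀ ψ ∈ S, Λ (ketBra (twoPairs ψ φ)) = ketBra (twoPairs ψ ψ)

/-- A state on a `D × D` system is maximally entangled: it has a Schmidt decomposition in which
all `D` Schmidt coefficients equal `1 / D`. -/
def IsMaximallyEntangled {D : ℕ} (ψ : EuclideanSpace ℂ (Fin D × Fin D)) : Prop :=
  ∃ u v : OrthonormalBasis (Fin D) ℂ (EuclideanSpace ℂ (Fin D)),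
    ψ = ((Real.sqrt D : ℝ) : ℂ)⁻¹ • ∑ r, tensorVec (u r) (v r)

/-- `D^{-1/2} ∑_{g ∈ G} |fg⟩^A |g⟩^B`. -/
def groupShiftA {D : ℕ} {G : Type} [Group G] [Fintype G]
    (u v : OrthonormalBasis G ℂ (EuclideanSpace ℂ (Fin D))) (f : G) :
    EuclideanSpace ℂ (Fin D × Fin D) :=
  ((Real.sqrt D : ℝ) : ℂ)⁻¹ • ∑ g, tensorVec (u (f * g)) (v g)

/-- `D^{-1/2} ∑_{g ∈ G} |g⟩^A |fg⟩^B`. -/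
def groupShiftB {D : ℕ} {G : Type} [Group G] [Fintype G]
    (u v : OrthonormalBasis G ℂ (EuclideanSpace ℂ (Fin D))) (f : G) :
    EuclideanSpace ℂ (Fin D × Fin D) :=
  ((Real.sqrt D : ℝ) : ℂ)⁻¹ • ∑ g, tensorVec (u g) (v (f * g))

/-- There are a finite group `G` and orthonormal bases `u` of Alice's and `v` of Bob's space, both
labelled by `G` (so that `G` has order `D`) and common to all states of `S`, in which every state
of `S` is, up to a global phase, `D^{-1/2} ∑_{g ∈ G} |fg⟩^A |g⟩^B` for some `f ∈ G`. -/
def IsGroupShiftedA {D : ℕ} (S : Set (EuclideanSpace ℂ (Fin D × Fin D))) : Prop :=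
  ∃ (G : Type) (_ : Group G) (_ : Fintype G)
    (u v : OrthonormalBasis G ℂ (EuclideanSpace ℂ (Fin D))),
    ∀ ψ ∈ S, ∃ (f : G) (c : ℂ), ‖c‖ = 1 ∧ ψ = c • groupShiftA u v f

/-- The same with `D^{-1/2} ∑_{g ∈ G} |g⟩^A |fg⟩^B`. -/
def IsGroupShiftedB {D : ℕ} (S : Set (EuclideanSpace ℂ (Fin D × Fin D))) : Prop :=
  ∃ (G : Type) (_ : Group G) (_ : Fintype G)
    (u v : OrthonormalBasis G ℂ (EuclideanSpace ℂ (Fin D))),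
    ∀ ψ ∈ S, ∃ (f : G) (c : ℂ), ‖c‖ = 1 ∧ ψ = c • groupShiftB u v f

end

/-!
Vectors of a bipartite system are written as matrices (`coeffMatrix`): a maximally entangled state
is `U / √D` with `U` unitary, `ψ ⊗ φ` becomes a Kronecker product, and `A ⊗ B` acts as
`M ↦ A * M * Bᵀ`.

*Cloning forces a group.* An LOCC operation has product Kraus operators `A i ⊗ B i`
(`IsLOCC.exists_kraus`), and since the output `ψ ⊗ ψ` is pure, each of them maps `ψ ⊗ φ` to a
multiple of `ψ ⊗ ψ` (`exists_smul_of_sum_ketBra_eq`). Fix a state `ψ₀ = U₀ / √D` of the set and a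
Kraus operator `A ⊗ B` that does not annihilate `ψ₀ ⊗ φ`. Then
`A * (U ⊗ X) * Bᵀ = c • (U ⊗ U)` for the matrices `U` of all states of the set, with `X` the matrix
of the blank state; as the right-hand side is invertible for `U₀`, so are `A`, `B` and `X`. Dividing
by the equation for `U₀` cancels `X` and `B`: after a change of phase, `T = U * U₀ᴴ` satisfies
`A * (T ⊗ 1) = (T ⊗ T) * A` (`exists_smul_mem_cloningGroup`). The unitaries with this property form
a group, and taking traces shows that the trace of such a `T` is `0` unless `T = 1`
(`trace_eq_zero_of_mem_cloningGroup`).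

*The group acts by translations.* Such a group `K` is finite, by orthogonality in the
Hilbert–Schmidt inner product, and its character is `D / |K|` times that of the regular
representation; the factor is an integer, being the dimension of the space of fixed vectors. So `K`
has the same character as its action by left translation on `G = K × ℤ/(D/|K|)`, and unitary
representations with equal characters are unitarily equivalent (`exists_unitary_intertwiner`, proved
by enlarging partially isometric intertwiners). The columns of the unitary equivalence are the basis
of Alice's space.

*Translations can be cloned.* The blank state is `ψ_1`, and both parties apply the controlled
translation `|x⟩|y⟩ ↦ |x⟩|xy⟩`, which intertwines `L f ⊗ 1` with `L f ⊗ L f` for the left regular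
representation `L`.

The version with the shift on Bob's side follows from `∑ g, |g⟩|fg⟩ = ∑ g, |f⁻¹g⟩|g⟩`.
-/

section
open scoped ComplexOrder

/-! ### Unitary equivalence of representations with equal characters -/

theorem Matrix.exists_trace_eq_natCast_of_isIdempotentElem {n : Type*} [Fintype n] [DecidableEq n]
    {P : Matrix n n ℂ} (hP : IsIdempotentElem P) :
    ∃ k : ℕ, k ≤ Fintype.card n ∧ P.trace = k := by
  have h : IsIdempotentElem (Matrix.toLin' P) := by
    rw [IsIdempotentElem, Module.End.mul_eq_comp, ← Matrix.toLin'_mul, hP]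
  have htr := (LinearMap.IsIdempotentElem.isProj_range _ h).trace
  refine ⟨_, ?_, by rw [← Matrix.trace_toLin'_eq, htr]⟩
  simpa using Submodule.finrank_le (LinearMap.range (Matrix.toLin' P))

theorem Matrix.eq_zero_of_isIdempotentElem {n : Type*} [Fintype n] {P : Matrix n n ℂ}
    (hP : IsIdempotentElem P) (hP' : Pᴴ = P) (h : P.trace = 0) : P = 0 := by
  rw [← hP.eq] at h
  nth_rewrite 1 [← hP'] at h
  rwa [Matrix.trace_conjTranspose_mul_self_eq_zero_iff] at h

/-- The square root of the pseudoinverse of a positive semidefinite matrix `N`. The idempotent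
`S * N * S` is the projection onto the range of `N`. -/
theorem Matrix.PosSemidef.exists_inv_sqrt {n : Type*} [Fintype n] [DecidableEq n]
    {N : Matrix n n ℂ} (hN : N.PosSemidef) :
    ∃ S : Matrix n n ℂ, Sᴴ = S ∧ (∀ X, Commute N X → Commute S X) ∧
      IsIdempotentElem (S * N * S) ∧ N * (S * N * S) = N := by
  have hsa : IsSelfAdjoint N := hN.1
  have hc : ∀ f : ℝ → ℝ, ContinuousOn f (spectrum ℝ N) := fun f =>
    (Matrix.finite_real_spectrum (A := N)).continuousOn f
  have hnn : ∀ x ∈ spectrum ℝ N, 0 ≤ x := by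
    intro x hx
    rw [hN.1.spectrum_real_eq_range_eigenvalues] at hx
    obtain ⟨i, rfl⟩ := hx
    exact hN.eigenvalues_nonneg i
  have hx1 : ∀ x : ℝ, 0 < x → (√x)⁻¹ * x * (√x)⁻¹ = 1 := by
    intro x h
    have h1 := Real.mul_self_sqrt h.le
    have h2 := Real.sqrt_pos.2 h
    field_simp
    nlinarith
  set S := cfc (fun x : ℝ => (√x)⁻¹) N with hS
  have hSNS : S * N * S = cfc (fun x : ℝ => (√x)⁻¹ * x * (√x)⁻¹) N := by
    rw [cfc_mul _ _ N (hc _) (hc _), cfc_mul _ _ N (hc _) (hc _), cfc_id' ℝ N]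
  refine ⟨S, cfc_predicate (fun x : ℝ => (√x)⁻¹) N, fun X hX => hsa.commute_cfc hX _, ?_, ?_⟩
  · rw [IsIdempotentElem, hSNS, ← cfc_mul _ _ N (hc _) (hc _)]
    refine cfc_congr fun x hx => ?_
    rcases (hnn x hx).eq_or_lt with h | h
    · simp [← h]
    · simp [hx1 x h]
  · have : cfc (fun x : ℝ => x) N * (S * N * S) = cfc (fun x : ℝ => x) N := by
      rw [hSNS, ← cfc_mul _ _ N (hc _) (hc _)]
      refine cfc_congr fun x hx => ?_
      rcases (hnn x hx).eq_or_lt with h | h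
      · simp [← h]
      · simp [hx1 x h]
    rwa [cfc_id' ℝ N] at this

theorem Matrix.mul_conjTranspose_mul_self_of_isIdempotentElem {m n : Type*} [Fintype m] [Fintype n]
    {W : Matrix m n ℂ} (hW : IsIdempotentElem (Wᴴ * W)) : W * (Wᴴ * W) = W := by
  classical
  have : (W * (1 - Wᴴ * W))ᴴ * (W * (1 - Wᴴ * W)) = 0 := by
    have h := hW.eq
    calc (W * (1 - Wᴴ * W))ᴴ * (W * (1 - Wᴴ * W))
        = Wᴴ * W - Wᴴ * W * (Wᴴ * W) - (Wᴴ * W * (Wᴴ * W) - Wᴴ * W * (Wᴴ * W) * (Wᴴ * W)) := by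
          simp only [Matrix.conjTranspose_mul, Matrix.conjTranspose_sub,
            Matrix.conjTranspose_one, Matrix.conjTranspose_conjTranspose]
          simp only [Matrix.mul_sub, Matrix.sub_mul, Matrix.mul_one, Matrix.one_mul,
            Matrix.mul_assoc]
      _ = 0 := by simp [h]
  rw [Matrix.conjTranspose_mul_self_eq_zero, Matrix.mul_sub, Matrix.mul_one, sub_eq_zero] at this
  exact this.symm

section Intertwiner
variable {H m n : Type*} [Group H] [Fintype H] [Fintype m] [DecidableEq m] [Fintype n]
  [DecidableEq n]

/-- Averaging over the group produces a nonzero intertwiner between subrepresentations, cut out by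
commuting orthogonal projections `P` and `Q`, that have the same nonzero character: if all averages
of matrix units vanished, then so would `∑ h, |tr (ρ h * P)| ^ 2`. -/
theorem exists_ne_zero_intertwiner (ρ : H →* Matrix m m ℂ) (σ : H →* Matrix n n ℂ)
    (hσ : ∀ h, (σ h)ᴴ = σ h⁻¹) {P : Matrix m m ℂ} {Q : Matrix n n ℂ}
    (hP : IsIdempotentElem P) (hQ : IsIdempotentElem Q) (hQ' : Qᴴ = Q)
    (hPρ : ∀ h, Commute P (ρ h)) (hQσ : ∀ h, Commute Q (σ h))
    (htr : ∀ h, (ρ h * P).trace = (σ h * Q).trace) (hP0 : P.trace ≠ 0) :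
    ∃ Y : Matrix m n ℂ, Y ≠ 0 ∧ (∀ h, ρ h * Y = Y * σ h) ∧ P * Y = Y ∧ Y * Q = Y := by
  let Y : Matrix m n ℂ → Matrix m n ℂ := fun X => ∑ h, (ρ h * P) * X * (Q * σ h⁻¹)
  have hY1 : ∀ X h, ρ h * Y X = Y X * σ h := by
    intro X h
    simp only [Y, Matrix.mul_sum, Matrix.sum_mul]
    refine Fintype.sum_equiv (Equiv.mulLeft h) _ _ fun k => ?_
    simp only [Equiv.coe_mulLeft, map_mul, mul_inv_rev, Matrix.mul_assoc]
    rw [← map_mul σ h⁻¹ h]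
    simp
  have hY2 : ∀ X, P * Y X = Y X := by
    intro X
    simp only [Y, Matrix.mul_sum]
    refine Finset.sum_congr rfl fun k _ => ?_
    have hk : P * (ρ k * P) = ρ k * P := by
      rw [← Matrix.mul_assoc, (hPρ k).eq, Matrix.mul_assoc, hP.eq]
    rw [← Matrix.mul_assoc, ← Matrix.mul_assoc P, hk]
  have hY3 : ∀ X, Y X * Q = Y X := by
    intro X
    simp only [Y, Matrix.sum_mul]
    refine Finset.sum_congr rfl fun k _ => ?_
    rw [Matrix.mul_assoc, Matrix.mul_assoc Q, ← (hQσ _).eq, ← Matrix.mul_assoc Q, hQ.eq]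
  by_contra hcon
  push Not at hcon
  have hY0 : ∀ X, Y X = 0 := by
    intro X
    by_contra h0
    exact hcon _ h0 (hY1 X) (hY2 X) (hY3 X)
  have hij : ∀ i j, ∑ h, (ρ h * P) i i * (Q * σ h⁻¹) j j = 0 := by
    intro i j
    have := congrFun (congrFun (hY0 (Matrix.single i j 1)) i) j
    simp only [Y, Matrix.sum_apply, Matrix.zero_apply] at this
    rw [← this]
    refine Finset.sum_congr rfl fun h _ => ?_
    rw [Matrix.mul_apply (M := ρ h * P * Matrix.single i j 1), Finset.sum_eq_single j]
    · simp
    · intro b _ hb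
      rw [Matrix.mul_single_apply_of_ne _ _ _ _ _ hb, zero_mul]
    · simp
  have hsum : ∑ h, (ρ h * P).trace * (Q * σ h⁻¹).trace = 0 := by
    simp only [Matrix.trace, Matrix.diag_apply, Finset.sum_mul_sum]
    rw [Finset.sum_comm]
    refine Finset.sum_eq_zero fun i _ => ?_
    rw [Finset.sum_comm]
    exact Finset.sum_eq_zero fun j _ => hij i j
  have hst : ∀ h, (Q * σ h⁻¹).trace = star (ρ h * P).trace := by
    intro h
    rw [htr h, ← Matrix.trace_conjTranspose, Matrix.conjTranspose_mul, hσ, hQ']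
  simp only [hst] at hsum
  rw [Finset.sum_eq_zero_iff_of_nonneg (fun h _ => mul_star_self_nonneg _)] at hsum
  have := hsum 1 (Finset.mem_univ _)
  simp at this
  exact hP0 this

/-- A partially isometric intertwiner that is not unitary can be enlarged. The complements of its
support and of its range have the same character; a nonzero intertwiner between them is made
partially isometric by its polar decomposition, and added. -/
theorem exists_larger_intertwiner (ρ : H →* Matrix m m ℂ) (σ : H →* Matrix n n ℂ)
    (hρ : ∀ h, (ρ h)ᴴ = ρ h⁻¹) (hσ : ∀ h, (σ h)ᴴ = σ h⁻¹)
    (htr : ∀ h, (ρ h).trace = (σ h).trace) {W : Matrix m n ℂ}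
    (hW : IsIdempotentElem (Wᴴ * W)) (hWρ : ∀ h, ρ h * W = W * σ h)
    (hne : (1 - Wᴴ * W).trace ≠ 0) :
    ∃ W' : Matrix m n ℂ, IsIdempotentElem (W'ᴴ * W') ∧ (∀ h, ρ h * W' = W' * σ h) ∧
      ∃ k : ℕ, 0 < k ∧ (W'ᴴ * W').trace = (Wᴴ * W).trace + k := by
  -- the adjoint of an intertwiner is an intertwiner in the other direction
  have hadj : ∀ Z : Matrix m n ℂ, (∀ h, ρ h * Z = Z * σ h) → ∀ h, σ h * Zᴴ = Zᴴ * ρ h := by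
    intro Z hZ h
    have := congrArg Matrix.conjTranspose (hZ h⁻¹)
    simp only [Matrix.conjTranspose_mul, hρ, hσ, inv_inv] at this
    exact this.symm
  have hWσ := hadj W hWρ
  have hWW : W * (Wᴴ * W) = W := Matrix.mul_conjTranspose_mul_self_of_isIdempotentElem hW
  have hWW' : Wᴴ * W * Wᴴ = Wᴴ := by
    have := congrArg Matrix.conjTranspose hWW
    simpa only [Matrix.conjTranspose_mul, Matrix.conjTranspose_conjTranspose] using this
  have hWWi : IsIdempotentElem (W * Wᴴ) := by
    rw [IsIdempotentElem, Matrix.mul_assoc, ← Matrix.mul_assoc Wᴴ, hWW']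
  have hPρ : ∀ h, Commute (W * Wᴴ) (ρ h) := by
    intro h
    rw [Commute, SemiconjBy, Matrix.mul_assoc, ← hWσ, ← Matrix.mul_assoc, ← hWρ, Matrix.mul_assoc]
  have hQσ : ∀ h, Commute (Wᴴ * W) (σ h) := by
    intro h
    rw [Commute, SemiconjBy, Matrix.mul_assoc, ← hWρ, ← Matrix.mul_assoc, ← hWσ, Matrix.mul_assoc]
  have htrW : ∀ h, (ρ h * (1 - W * Wᴴ)).trace = (σ h * (1 - Wᴴ * W)).trace := by
    intro h
    rw [mul_sub, mul_sub, mul_one, mul_one, Matrix.trace_sub, Matrix.trace_sub, htr h,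
      ← Matrix.mul_assoc, hWρ h, Matrix.trace_mul_comm, ← Matrix.mul_assoc, Matrix.trace_mul_comm]
  have htr1 : (1 - W * Wᴴ).trace ≠ 0 := by
    have := htrW 1
    rw [map_one, map_one, one_mul, one_mul] at this
    rwa [this]
  obtain ⟨Y, hY0, hYρ, hPY, hYQ⟩ := exists_ne_zero_intertwiner ρ σ hσ hWWi.one_sub hW.one_sub
    (by simp) (fun h => (Commute.one_left _).sub_left (hPρ h))
    (fun h => (Commute.one_left _).sub_left (hQσ h)) htrW htr1
  have hWY : Wᴴ * Y = 0 := by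
    rw [← hPY, ← Matrix.mul_assoc, Matrix.mul_sub, Matrix.mul_one, ← Matrix.mul_assoc, hWW',
      sub_self, Matrix.zero_mul]
  have hYW : Y * (Wᴴ * W) = 0 := by
    rw [Matrix.mul_sub, Matrix.mul_one, sub_eq_self] at hYQ
    exact hYQ
  have hYσ := hadj Y hYρ
  obtain ⟨S, hS, hSc, hSi, hSN⟩ := (Matrix.posSemidef_conjTranspose_mul_self Y).exists_inv_sqrt
  have hSσ : ∀ h, Commute S (σ h) := by
    intro h
    apply hSc
    rw [Commute, SemiconjBy, Matrix.mul_assoc, ← hYρ, ← Matrix.mul_assoc, ← hYσ, Matrix.mul_assoc]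
  have hSW : Commute S (Wᴴ * W) := by
    apply hSc
    have h2 := congrArg Matrix.conjTranspose hYW
    simp only [Matrix.conjTranspose_mul, Matrix.conjTranspose_conjTranspose,
      Matrix.conjTranspose_zero] at h2
    rw [Commute, SemiconjBy, Matrix.mul_assoc, hYW, ← Matrix.mul_assoc (Wᴴ * W), h2]
    simp
  have hVW : Y * S * Wᴴ = 0 := by
    rw [← hWW', Matrix.mul_assoc, ← Matrix.mul_assoc S, hSW.eq, ← Matrix.mul_assoc,
      ← Matrix.mul_assoc, hYW]
    simp
  have hWV : Wᴴ * (Y * S) = 0 := by rw [← Matrix.mul_assoc, hWY, Matrix.zero_mul]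
  have hWV' : (Y * S)ᴴ * W = 0 := by
    have := congrArg Matrix.conjTranspose hWV
    simpa only [Matrix.conjTranspose_mul, Matrix.conjTranspose_conjTranspose,
      Matrix.conjTranspose_zero] using this
  have hVW' : W * (Y * S)ᴴ = 0 := by
    have := congrArg Matrix.conjTranspose hVW
    simpa only [Matrix.conjTranspose_mul, Matrix.conjTranspose_conjTranspose,
      Matrix.conjTranspose_zero] using this
  have hVV : (Y * S)ᴴ * (Y * S) = S * (Yᴴ * Y) * S := by
    rw [Matrix.conjTranspose_mul, hS]
    simp only [Matrix.mul_assoc]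
  have hgram : (W + Y * S)ᴴ * (W + Y * S) = Wᴴ * W + (Y * S)ᴴ * (Y * S) := by
    rw [Matrix.conjTranspose_add, Matrix.add_mul, Matrix.mul_add, Matrix.mul_add, hWV, hWV',
      add_zero, zero_add]
  refine ⟨W + Y * S, ?_, ?_, ?_⟩
  · have e1 : Wᴴ * W * ((Y * S)ᴴ * (Y * S)) = 0 := by
      rw [Matrix.mul_assoc, ← Matrix.mul_assoc W, hVW']; simp
    have e2 : (Y * S)ᴴ * (Y * S) * (Wᴴ * W) = 0 := by
      rw [Matrix.mul_assoc, ← Matrix.mul_assoc (Y * S) Wᴴ, hVW]; simp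
    rw [hgram, IsIdempotentElem, add_mul, mul_add, mul_add, e1, e2, hW.eq, hVV, hSi.eq, add_zero,
      zero_add]
  · intro h
    rw [Matrix.mul_add, Matrix.add_mul, hWρ, ← Matrix.mul_assoc, hYρ, Matrix.mul_assoc,
      Matrix.mul_assoc, (hSσ h).eq]
  · obtain ⟨k, -, hk⟩ := Matrix.exists_trace_eq_natCast_of_isIdempotentElem hSi
    refine ⟨k, ?_, by rw [hgram, Matrix.trace_add, hVV, hk]⟩
    rw [Nat.pos_iff_ne_zero]
    rintro rfl
    rw [← hVV, Nat.cast_zero, Matrix.trace_conjTranspose_mul_self_eq_zero_iff] at hk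
    rw [← hVV, hk, Matrix.mul_zero, Matrix.mul_zero, eq_comm,
      Matrix.conjTranspose_mul_self_eq_zero] at hSN
    exact hY0 hSN

/-- Two unitary matrix representations of a finite group with the same character are unitarily
equivalent. -/
theorem exists_unitary_intertwiner (ρ : H →* Matrix m m ℂ) (σ : H →* Matrix n n ℂ)
    (hρ : ∀ h, (ρ h)ᴴ = ρ h⁻¹) (hσ : ∀ h, (σ h)ᴴ = σ h⁻¹)
    (htr : ∀ h, (ρ h).trace = (σ h).trace) :
    ∃ W : Matrix m n ℂ, Wᴴ * W = 1 ∧ W * Wᴴ = 1 ∧ ∀ h, ρ h * W = W * σ h := by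
  -- partially isometric intertwiners of arbitrarily large rank exist unless some has full rank
  have key : ∀ k : ℕ, ∃ W : Matrix m n ℂ, IsIdempotentElem (Wᴴ * W) ∧ (∀ h, ρ h * W = W * σ h) ∧
      ((1 - Wᴴ * W).trace = 0 ∨ ∃ l : ℕ, k ≤ l ∧ (Wᴴ * W).trace = l) := by
    intro k
    induction k with
    | zero => exact ⟨0, by simp [IsIdempotentElem], by simp, Or.inr ⟨0, le_rfl, by simp⟩⟩
    | succ k ih =>
      obtain ⟨W, hW, hWρ, h⟩ := ih
      by_cases h0 : (1 - Wᴴ * W).trace = 0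
      · exact ⟨W, hW, hWρ, Or.inl h0⟩
      obtain ⟨l, hkl, hl⟩ := h.resolve_left h0
      obtain ⟨W', hW', hWρ', j, hj, hj'⟩ := exists_larger_intertwiner ρ σ hρ hσ htr hW hWρ h0
      exact ⟨W', hW', hWρ', Or.inr ⟨l + j, by omega, by rw [hj', hl]; push_cast; rfl⟩⟩
  obtain ⟨W, hW, hWρ, h⟩ := key (Fintype.card n + 1)
  have h0 : (1 - Wᴴ * W).trace = 0 := by
    refine h.resolve_right ?_
    rintro ⟨l, hl, hl'⟩
    obtain ⟨k, hk, hk'⟩ := Matrix.exists_trace_eq_natCast_of_isIdempotentElem hW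
    rw [hl', Nat.cast_inj] at hk'
    omega
  have hWW : W * (Wᴴ * W) = W := Matrix.mul_conjTranspose_mul_self_of_isIdempotentElem hW
  have hWWi : IsIdempotentElem (W * Wᴴ) := by
    rw [IsIdempotentElem, ← Matrix.mul_assoc, Matrix.mul_assoc W, hWW]
  have h0' : (1 - W * Wᴴ).trace = 0 := by
    have h1 := htr 1
    rw [map_one, map_one] at h1
    rw [Matrix.trace_sub, h1, Matrix.trace_mul_comm, ← Matrix.trace_sub, h0]
  exact ⟨W,
    (sub_eq_zero.1 (Matrix.eq_zero_of_isIdempotentElem hW.one_sub (by simp) h0)).symm,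
    (sub_eq_zero.1 (Matrix.eq_zero_of_isIdempotentElem hWWi.one_sub (by simp) h0')).symm, hWρ⟩

end Intertwiner
end

/-! ### Groups of unitaries whose character vanishes off the identity -/

/-- The matrices of the left regular representation of `G`. -/
def leftRegularMatrix (G : Type*) [Group G] [Fintype G] [DecidableEq G] : G →* Matrix G G ℂ where
  toFun f := Matrix.of fun a b => if a = f * b then 1 else 0
  map_one' := by ext a b; simp [Matrix.one_apply]
  map_mul' f g := by
    ext a b
    simp [Matrix.mul_apply, mul_assoc, mul_ite]

section
variable {G : Type*} [Group G] [Fintype G] [DecidableEq G]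

theorem leftRegularMatrix_apply (f a b : G) :
    leftRegularMatrix G f a b = if a = f * b then 1 else 0 := rfl

theorem mul_leftRegularMatrix_apply {m : Type*} (M : Matrix m G ℂ) (f : G) (i : m) (g : G) :
    (M * leftRegularMatrix G f) i g = M i (f * g) := by
  simp [Matrix.mul_apply, leftRegularMatrix_apply]

theorem conjTranspose_leftRegularMatrix (f : G) :
    (leftRegularMatrix G f)ᴴ = leftRegularMatrix G f⁻¹ := by
  ext a b
  simp only [Matrix.conjTranspose_apply, leftRegularMatrix_apply, eq_inv_mul_iff_mul_eq,
    eq_comm (a := b), apply_ite star, star_one, star_zero]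

theorem trace_leftRegularMatrix (f : G) :
    (leftRegularMatrix G f).trace = if f = 1 then (Fintype.card G : ℂ) else 0 := by
  simp only [Matrix.trace, Matrix.diag_apply, leftRegularMatrix_apply, right_eq_mul]
  split_ifs <;> simp
end

section
variable {n : Type*} [Fintype n] [DecidableEq n]

/-- Distinct elements of `K` are orthogonal in the Hilbert–Schmidt inner product, hence linearly
independent. -/
theorem finite_of_trace_eq_zero [Nonempty n] (K : Subgroup (Matrix.unitaryGroup n ℂ))
    (hK : ∀ T ∈ K, T ≠ 1 → (T : Matrix n n ℂ).trace = 0) : Finite K := by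
  have hli : LinearIndependent ℂ (fun T : K => ((T : Matrix.unitaryGroup n ℂ) : Matrix n n ℂ)) := by
    rw [linearIndependent_iff']
    intro s c hs T₀ hT₀
    have h := congrArg (fun M => (((T₀⁻¹ : K) : Matrix.unitaryGroup n ℂ) * M : Matrix n n ℂ).trace)
      hs
    simp only [Finset.mul_sum, Matrix.trace_sum, mul_smul_comm, Matrix.trace_smul, mul_zero,
      Matrix.trace_zero] at h
    rw [Finset.sum_eq_single_of_mem T₀ hT₀] at h
    · have h1 : ((((T₀⁻¹ : K) : Matrix.unitaryGroup n ℂ) : Matrix n n ℂ) *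
          ((T₀ : Matrix.unitaryGroup n ℂ) : Matrix n n ℂ)) = 1 := by
        have : (((T₀⁻¹ * T₀ : K) : Matrix.unitaryGroup n ℂ) : Matrix n n ℂ) = 1 := by
          rw [inv_mul_cancel]; rfl
        exact this
      rw [h1, Matrix.trace_one, smul_eq_mul, mul_eq_zero] at h
      exact h.resolve_right (by simp)
    · intro T _ hT
      have h2 := hK _ (T₀⁻¹ * T).2 (by
        intro h0
        apply hT
        have h3 : T₀⁻¹ * T = 1 := Subtype.ext h0
        exact (inv_mul_eq_one.1 h3).symm)
      have h4 : (((T₀⁻¹ : K) : Matrix.unitaryGroup n ℂ) : Matrix n n ℂ) *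
          ((T : Matrix.unitaryGroup n ℂ) : Matrix n n ℂ) =
          (((T₀⁻¹ * T : K) : Matrix.unitaryGroup n ℂ) : Matrix n n ℂ) := rfl
      rw [h4, h2, smul_zero]
  exact hli.finite

/-- The quotient of the dimension by the order of the group is the trace of the projection onto the
vectors that the group fixes, hence a natural number. -/
theorem card_dvd_of_trace_eq_zero {H : Type*} [Group H] [Fintype H] (σ : H →* Matrix n n ℂ)
    (hσ : ∀ h, h ≠ 1 → (σ h).trace = 0) :
    Fintype.card H ∣ Fintype.card n := by
  have hc : (Fintype.card H : ℂ) ≠ 0 := by simp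
  set P : Matrix n n ℂ := (Fintype.card H : ℂ)⁻¹ • ∑ h, σ h with hP
  have h1 : ∀ h, σ h * ∑ k, σ k = ∑ k, σ k := by
    intro h
    rw [Finset.mul_sum]
    exact Fintype.sum_equiv (Equiv.mulLeft h) _ _ fun k => (map_mul σ h k).symm
  have hPi : IsIdempotentElem P := by
    rw [IsIdempotentElem, hP, smul_mul_smul_comm, Finset.sum_mul]
    simp only [h1]
    rw [Finset.sum_const, Finset.card_univ, ← Nat.cast_smul_eq_nsmul ℂ, smul_smul]
    congr 1
    field_simp
  obtain ⟨k, -, hk⟩ := Matrix.exists_trace_eq_natCast_of_isIdempotentElem hPi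
  rw [hP, Matrix.trace_smul, Matrix.trace_sum, Finset.sum_eq_single 1 (fun h _ hh => hσ h hh)
    (by simp), map_one, Matrix.trace_one, smul_eq_mul, inv_mul_eq_iff_eq_mul₀ hc] at hk
  exact ⟨k, by exact_mod_cast hk⟩

/-- A group `K` of unitaries whose nontrivial elements are traceless acts, in the orthonormal basis
formed by the columns of `W`, by left translations of a group `G` whose order is the dimension. The
proof takes for `G` the product of `K` with a cyclic group, as the representation is a multiple of
the regular one. -/
theorem exists_leftRegular_of_trace_eq_zero.{u} {n : Type u} [Fintype n] [DecidableEq n]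
    [Nonempty n] (K : Subgroup (Matrix.unitaryGroup n ℂ))
    (hK : ∀ T ∈ K, T ≠ 1 → (T : Matrix n n ℂ).trace = 0) :
    ∃ (G : Type u) (_ : Group G) (_ : Fintype G) (_ : DecidableEq G) (j : K →* G)
      (W : Matrix n G ℂ), Wᴴ * W = 1 ∧ W * Wᴴ = 1 ∧
        ∀ T : K, ((T : Matrix.unitaryGroup n ℂ) : Matrix n n ℂ) * W =
          W * leftRegularMatrix G (j T) := by
  classical
  have := finite_of_trace_eq_zero K hK
  have := Fintype.ofFinite K
  let σ : K →* Matrix n n ℂ := (Matrix.unitaryGroup n ℂ).subtype.comp K.subtype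
  have hσ0 : ∀ h, h ≠ 1 → (σ h).trace = 0 := by
    intro h hh
    exact hK h h.2 (fun h0 => hh (Subtype.ext h0))
  obtain ⟨k, hk⟩ := card_dvd_of_trace_eq_zero σ hσ0
  have hk0 : k ≠ 0 := by
    rintro rfl
    simp at hk
  have : NeZero k := ⟨hk0⟩
  let G := K × Multiplicative (ZMod k)
  let j : K →* G := MonoidHom.inl _ _
  obtain ⟨W, h1, h2, h3⟩ := exists_unitary_intertwiner σ ((leftRegularMatrix G).comp j)
    (fun h => rfl) (fun h => by
      rw [MonoidHom.comp_apply, MonoidHom.comp_apply, conjTranspose_leftRegularMatrix, map_inv j])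
    (by
      intro h
      change (σ h).trace = (leftRegularMatrix G (j h)).trace
      rw [trace_leftRegularMatrix]
      by_cases hh : h = 1
      · subst hh
        rw [map_one, map_one, if_pos rfl, Matrix.trace_one, hk]
        simp [G]
      · rw [hσ0 h hh, if_neg]
        intro h0
        exact hh (Prod.ext_iff.1 h0).1)
  exact ⟨G, inferInstance, inferInstance, inferInstance, j, W, h1, h2, h3⟩
end

/-! ### LOCC operations are separable -/

/-- Every LOCC operation has Kraus operators that are tensor products. (Their completeness
relation is not part of the claim.) -/
theorem IsLOCC.exists_kraus {α' β' : Type} [Fintype α'] [DecidableEq α'] [Fintype β']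
    [DecidableEq β'] {α β : Type} [Fintype α] [DecidableEq α] [Fintype β] [DecidableEq β]
    {Λ : Matrix (α × β) (α × β) ℂ → Matrix (α' × β') (α' × β') ℂ} (h : IsLOCC α' β' α β Λ) :
    ∃ (ι : Type) (_ : Fintype ι) (A : ι → Matrix α' α ℂ) (B : ι → Matrix β' β ℂ),
      ∀ ρ, Λ ρ = ∑ i, (A i ⊗ₖ B i) * ρ * (A i ⊗ₖ B i)ᴴ := by
  induction h with
  | finish => exact ⟨Unit, inferInstance, fun _ => 1, fun _ => 1, fun ρ => by simp⟩
  | alice α β n γ K hK Λ hΛ ih =>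
    choose ι hι A B h using ih
    refine ⟨Σ k, ι k, inferInstance, fun p => A p.1 p.2 * K p.1, fun p => B p.1 p.2, fun ρ => ?_⟩
    rw [Fintype.sum_sigma]
    refine Finset.sum_congr rfl fun k _ => ?_
    rw [h]
    refine Finset.sum_congr rfl fun i _ => ?_
    have e : (A k i * K k) ⊗ₖ B k i = (A k i ⊗ₖ B k i) * (K k ⊗ₖ (1 : Matrix β β ℂ)) := by
      rw [← Matrix.mul_kronecker_mul, Matrix.mul_one]
    rw [e, Matrix.conjTranspose_mul]
    simp only [Matrix.mul_assoc]
  | bob α β n γ K hK Λ hΛ ih =>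
    choose ι hι A B h using ih
    refine ⟨Σ k, ι k, inferInstance, fun p => A p.1 p.2, fun p => B p.1 p.2 * K p.1, fun ρ => ?_⟩
    rw [Fintype.sum_sigma]
    refine Finset.sum_congr rfl fun k _ => ?_
    rw [h]
    refine Finset.sum_congr rfl fun i _ => ?_
    have e : A k i ⊗ₖ (B k i * K k) = (A k i ⊗ₖ B k i) * ((1 : Matrix α α ℂ) ⊗ₖ K k) := by
      rw [← Matrix.mul_kronecker_mul, Matrix.mul_one]
    rw [e, Matrix.conjTranspose_mul]
    simp only [Matrix.mul_assoc]

theorem mul_ketBra_mul_conjTranspose {ι κ : Type} [Fintype ι] (M : Matrix κ ι ℂ)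
    (x : EuclideanSpace ℂ ι) :
    M * ketBra x * Mᴴ = ketBra (WithLp.toLp 2 (M *ᵥ x) : EuclideanSpace ℂ κ) := by
  have h : ∀ {ι : Type} (x : EuclideanSpace ℂ ι), ketBra x = Matrix.vecMulVec x (star ⇑x) :=
    fun x => rfl
  rw [h, h, Matrix.mul_vecMulVec, Matrix.vecMulVec_mul, Matrix.star_mulVec]

/-- A pure state is an extreme point: a decomposition into rank-one operators consists of multiples
of it. -/
theorem exists_smul_of_sum_ketBra_eq {ι κ : Type} [Fintype ι] [Fintype κ]
    {v : ι → EuclideanSpace ℂ κ} {w : EuclideanSpace ℂ κ}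
    (h : ∑ i, ketBra (v i) = ketBra w) (i : ι) : ∃ c : ℂ, v i = c • w := by
  have hq : ∀ z x : EuclideanSpace ℂ κ,
      star (⇑z) ⬝ᵥ (ketBra x *ᵥ ⇑z) = ((‖inner ℂ x z‖ ^ 2 : ℝ) : ℂ) := by
    intro z x
    have hk : ketBra x = Matrix.vecMulVec x (star ⇑x) := rfl
    rw [hk, Matrix.vecMulVec_mulVec, dotProduct_smul, EuclideanSpace.inner_eq_star_dotProduct,
      dotProduct_comm (star ⇑x), op_smul_eq_smul, smul_eq_mul]
    have hc : star ⇑z ⬝ᵥ ⇑x = star (⇑z ⬝ᵥ star ⇑x) := by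
      simp [dotProduct]
    rw [hc, Complex.ofReal_pow, ← Complex.conj_mul', mul_comm]
    rfl
  have horth : ∀ z, inner ℂ w z = 0 → inner ℂ (v i) z = 0 := by
    intro z hz
    have h1 := congrArg (fun M => star ⇑z ⬝ᵥ (M *ᵥ ⇑z)) h
    simp only [Matrix.sum_mulVec, dotProduct_sum, hq, hz] at h1
    rw [← Complex.ofReal_sum, Complex.ofReal_inj, norm_zero, zero_pow two_ne_zero,
      Finset.sum_eq_zero_iff_of_nonneg (fun _ _ => by positivity)] at h1
    simpa using h1 i (Finset.mem_univ i)
  have hmem : v i ∈ (ℂ ∙ w)ᗮᗮ := by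
    rw [Submodule.mem_orthogonal']
    intro z hz
    exact horth z (Submodule.mem_orthogonal_singleton_iff_inner_right.1 hz)
  rw [Submodule.orthogonal_orthogonal, Submodule.mem_span_singleton] at hmem
  obtain ⟨c, hc⟩ := hmem
  exact ⟨c, hc.symm⟩

/-! ### Bipartite vectors as matrices -/

/-- The matrix of coefficients of a vector of a bipartite system. -/
def coeffMatrix {α β : Type} (ψ : EuclideanSpace ℂ (α × β)) : Matrix α β ℂ :=
  Matrix.of fun i j => ψ (i, j)

theorem coeffMatrix_injective {α β : Type} :
    Function.Injective (coeffMatrix : EuclideanSpace ℂ (α × β) → Matrix α β ℂ) := by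
  intro ψ φ h
  ext p
  exact congrFun (congrFun h p.1) p.2

theorem coeffMatrix_smul {α β : Type} (c : ℂ) (ψ : EuclideanSpace ℂ (α × β)) :
    coeffMatrix (c • ψ) = c • coeffMatrix ψ := rfl

theorem coeffMatrix_twoPairs {A B a b : Type} (ψ : EuclideanSpace ℂ (A × B))
    (φ : EuclideanSpace ℂ (a × b)) :
    coeffMatrix (twoPairs ψ φ) = coeffMatrix ψ ⊗ₖ coeffMatrix φ := rfl

theorem coeffMatrix_kronecker_mulVec {α β α' β' : Type} [Fintype α] [Fintype β]
    (A : Matrix α' α ℂ) (B : Matrix β' β ℂ) (ψ : EuclideanSpace ℂ (α × β)) :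
    coeffMatrix (WithLp.toLp 2 ((A ⊗ₖ B) *ᵥ ψ)) = A * coeffMatrix ψ * Bᵀ := by
  ext i j
  simp only [coeffMatrix, Matrix.of_apply, Matrix.mulVec, dotProduct, Matrix.mul_apply,
    Fintype.sum_prod_type, Matrix.kroneckerMap_apply, Matrix.transpose_apply, Finset.sum_mul]
  rw [Finset.sum_comm]
  refine Finset.sum_congr rfl fun x _ => Finset.sum_congr rfl fun y _ => ?_
  ring

/-- The matrix whose columns are the vectors of an orthonormal basis. -/
noncomputable def columnMatrix {D : ℕ} {G : Type} [Fintype G]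
    (u : OrthonormalBasis G ℂ (EuclideanSpace ℂ (Fin D))) : Matrix (Fin D) G ℂ :=
  Matrix.of fun i g => u g i

theorem card_eq_of_orthonormalBasis {D : ℕ} {G : Type} [Fintype G]
    (u : OrthonormalBasis G ℂ (EuclideanSpace ℂ (Fin D))) : Fintype.card G = D := by
  simpa using (Module.finrank_eq_card_basis u.toBasis).symm

section
variable {D : ℕ} {G : Type} [Fintype G] [DecidableEq G]

theorem conjTranspose_columnMatrix_mul_self
    (u : OrthonormalBasis G ℂ (EuclideanSpace ℂ (Fin D))) :
    (columnMatrix u)ᴴ * columnMatrix u = 1 := by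
  ext g h
  have := orthonormal_iff_ite.1 u.orthonormal g h
  rw [Matrix.one_apply, ← this, PiLp.inner_apply]
  simp [columnMatrix, Matrix.mul_apply, mul_comm]

theorem columnMatrix_mul_conjTranspose_self
    (u : OrthonormalBasis G ℂ (EuclideanSpace ℂ (Fin D))) :
    columnMatrix u * (columnMatrix u)ᴴ = 1 :=
  (Matrix.mul_eq_one_comm_of_card_eq _ _ _ (by simp [card_eq_of_orthonormalBasis u])).1
    (conjTranspose_columnMatrix_mul_self u)

theorem exists_columnMatrix_eq {W : Matrix (Fin D) G ℂ} (h1 : Wᴴ * W = 1) (h2 : W * Wᴴ = 1) :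
    ∃ u : OrthonormalBasis G ℂ (EuclideanSpace ℂ (Fin D)), columnMatrix u = W := by
  have hon : Orthonormal ℂ
      (fun g => (WithLp.toLp 2 fun i => W i g : EuclideanSpace ℂ (Fin D))) := by
    rw [orthonormal_iff_ite]
    intro g h
    have := congrFun (congrFun h1 g) h
    rw [Matrix.one_apply] at this
    rw [← this, PiLp.inner_apply]
    simp [Matrix.mul_apply, mul_comm]
  have hcard : (Fintype.card G : ℂ) = D := by
    have := Matrix.trace_mul_comm Wᴴ W
    rw [h1, h2, Matrix.trace_one, Matrix.trace_one] at this
    simpa using this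
  have hspan := hon.linearIndependent.span_eq_top_of_card_eq_finrank'
    (by simpa using (by exact_mod_cast hcard : Fintype.card G = D))
  refine ⟨OrthonormalBasis.mk hon hspan.ge, ?_⟩
  ext i g
  simp [columnMatrix]

end

theorem coeffMatrix_groupShiftA {D : ℕ} {G : Type} [Group G] [Fintype G] [DecidableEq G]
    (u v : OrthonormalBasis G ℂ (EuclideanSpace ℂ (Fin D))) (f : G) :
    coeffMatrix (groupShiftA u v f) = ((Real.sqrt D : ℝ) : ℂ)⁻¹ •
      (columnMatrix u * leftRegularMatrix G f * (columnMatrix v)ᵀ) := by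
  ext i j
  rw [Matrix.smul_apply, Matrix.mul_apply]
  simp only [mul_leftRegularMatrix_apply]
  simp [coeffMatrix, groupShiftA, tensorVec, columnMatrix]

/-- The coefficient matrix of a maximally entangled state is a multiple of a unitary. -/
theorem IsMaximallyEntangled.exists_unitary {D : ℕ} {ψ : EuclideanSpace ℂ (Fin D × Fin D)}
    (h : IsMaximallyEntangled ψ) :
    ∃ U ∈ Matrix.unitaryGroup (Fin D) ℂ, coeffMatrix ψ = ((Real.sqrt D : ℝ) : ℂ)⁻¹ • U := by
  obtain ⟨u, v, rfl⟩ := h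
  have hu := columnMatrix_mul_conjTranspose_self u
  have hv := columnMatrix_mul_conjTranspose_self v
  refine ⟨columnMatrix u * (columnMatrix v)ᵀ, ?_, ?_⟩
  · refine mul_mem (Matrix.mem_unitaryGroup_iff.2 hu) ?_
    exact Matrix.transpose_mem_unitaryGroup_iff.2 (Matrix.mem_unitaryGroup_iff.2 hv)
  · ext i j
    simp [coeffMatrix, tensorVec, columnMatrix, Matrix.mul_apply]

theorem groupShiftB_eq_groupShiftA_inv {D : ℕ} {G : Type} [Group G] [Fintype G]
    (u v : OrthonormalBasis G ℂ (EuclideanSpace ℂ (Fin D))) (f : G) :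
    groupShiftB u v f = groupShiftA u v f⁻¹ := by
  unfold groupShiftA groupShiftB
  congr 1
  exact Fintype.sum_equiv (Equiv.mulLeft f) _ _ fun g => by simp

theorem isGroupShiftedA_iff_isGroupShiftedB {D : ℕ} (S : Set (EuclideanSpace ℂ (Fin D × Fin D))) :
    IsGroupShiftedA S ↔ IsGroupShiftedB S := by
  refine exists_congr fun G => exists_congr fun _ => exists_congr fun _ => exists_congr fun u =>
    exists_congr fun v => forall₂_congr fun ψ _ => ?_
  constructor
  · rintro ⟨f, h⟩
    exact ⟨f⁻¹, by simpa [groupShiftB_eq_groupShiftA_inv] using h⟩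
  · rintro ⟨f, h⟩
    exact ⟨f⁻¹, by simpa [groupShiftB_eq_groupShiftA_inv] using h⟩

/-! ### The group attached to a product operator that clones -/

theorem Matrix.transpose_conjTranspose_comm {m n : Type*} (M : Matrix m n ℂ) : Mᵀᴴ = Mᴴᵀ := rfl

section
variable {n : Type*} [Fintype n] [DecidableEq n]

/-- The unitaries `T` for which conjugation by `A` turns `T ⊗ 1` into `T ⊗ T`. -/
def cloningGroup (A : Matrix (n × n) (n × n) ℂ) : Subgroup (Matrix.unitaryGroup n ℂ) where
  carrier := {T | A * ((T : Matrix n n ℂ) ⊗ₖ (1 : Matrix n n ℂ)) =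
    ((T : Matrix n n ℂ) ⊗ₖ (T : Matrix n n ℂ)) * A}
  one_mem' := by simp
  mul_mem' := by
    intro T R hT hR
    simp only [Set.mem_ofPred_eq] at hT hR ⊢
    have e : ((T * R : Matrix.unitaryGroup n ℂ) : Matrix n n ℂ) ⊗ₖ (1 : Matrix n n ℂ) =
        ((T : Matrix n n ℂ) ⊗ₖ (1 : Matrix n n ℂ)) *
          ((R : Matrix n n ℂ) ⊗ₖ (1 : Matrix n n ℂ)) := by
      rw [← Matrix.mul_kronecker_mul, Matrix.mul_one]
      rfl
    have e' : ((T * R : Matrix.unitaryGroup n ℂ) : Matrix n n ℂ) ⊗ₖ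
        ((T * R : Matrix.unitaryGroup n ℂ) : Matrix n n ℂ) =
        ((T : Matrix n n ℂ) ⊗ₖ (T : Matrix n n ℂ)) *
          ((R : Matrix n n ℂ) ⊗ₖ (R : Matrix n n ℂ)) := by
      rw [← Matrix.mul_kronecker_mul]
      rfl
    rw [e, e', ← Matrix.mul_assoc, hT, Matrix.mul_assoc, hR, Matrix.mul_assoc]
  inv_mem' := by
    intro T hT
    simp only [Set.mem_ofPred_eq] at hT ⊢
    have h1 : (T : Matrix n n ℂ) * ((T⁻¹ : Matrix.unitaryGroup n ℂ) : Matrix n n ℂ) = 1 :=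
      Matrix.mem_unitaryGroup_iff.1 T.2
    have h2 : ((T⁻¹ : Matrix.unitaryGroup n ℂ) : Matrix n n ℂ) * (T : Matrix n n ℂ) = 1 :=
      Matrix.mem_unitaryGroup_iff'.1 T.2
    generalize ((T⁻¹ : Matrix.unitaryGroup n ℂ) : Matrix n n ℂ) = R at *
    calc A * (R ⊗ₖ (1 : Matrix n n ℂ))
        = (R ⊗ₖ R) * (((T : Matrix n n ℂ) ⊗ₖ (T : Matrix n n ℂ)) * A) *
            (R ⊗ₖ (1 : Matrix n n ℂ)) := by
          rw [← Matrix.mul_assoc, ← Matrix.mul_kronecker_mul, h2, Matrix.one_kronecker_one,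
            Matrix.one_mul]
      _ = (R ⊗ₖ R) * A := by
          rw [← hT, Matrix.mul_assoc, Matrix.mul_assoc, ← Matrix.mul_kronecker_mul, h1,
            Matrix.one_mul, Matrix.one_kronecker_one, Matrix.mul_one]

/-- Taking traces gives `χ(T) ^ 2 = card n * χ(T)`, so `χ(T)` is `0` or `card n`, and a unitary
whose trace is `card n` is the identity. -/
theorem trace_eq_zero_of_mem_cloningGroup {A : Matrix (n × n) (n × n) ℂ} (hA : IsUnit A.det)
    {T : Matrix.unitaryGroup n ℂ} (hT : T ∈ cloningGroup A) (hT1 : T ≠ 1) :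
    (T : Matrix n n ℂ).trace = 0 := by
  have h : A * ((T : Matrix n n ℂ) ⊗ₖ (1 : Matrix n n ℂ)) =
    ((T : Matrix n n ℂ) ⊗ₖ (T : Matrix n n ℂ)) * A := hT
  have htr : (T : Matrix n n ℂ).trace * (Fintype.card n : ℂ) =
      (T : Matrix n n ℂ).trace * (T : Matrix n n ℂ).trace := by
    rw [← Matrix.trace_one (n := n), ← Matrix.trace_kronecker, ← Matrix.trace_kronecker]
    calc _ = (A⁻¹ * (A * ((T : Matrix n n ℂ) ⊗ₖ (1 : Matrix n n ℂ)))).trace := by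
          rw [← Matrix.mul_assoc, Matrix.nonsing_inv_mul _ hA, Matrix.one_mul]
      _ = _ := by
          rw [h, Matrix.trace_mul_comm, Matrix.mul_assoc, Matrix.mul_nonsing_inv _ hA,
            Matrix.mul_one]
  by_contra h0
  have hc := mul_left_cancel₀ h0 htr
  apply hT1
  have hU : (T : Matrix n n ℂ)ᴴ * T = 1 := Matrix.mem_unitaryGroup_iff'.1 T.2
  have hz : (((T : Matrix n n ℂ) - 1)ᴴ * ((T : Matrix n n ℂ) - 1)).trace = 0 := by
    rw [Matrix.conjTranspose_sub, Matrix.conjTranspose_one, sub_mul, mul_sub, hU, one_mul, mul_one,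
      Matrix.trace_sub, Matrix.trace_sub, Matrix.trace_sub, Matrix.trace_conjTranspose, ← hc,
      Matrix.trace_one]
    simp
  open scoped ComplexOrder in
  rw [Matrix.trace_conjTranspose_mul_self_eq_zero_iff, sub_eq_zero] at hz
  exact Subtype.ext hz

theorem norm_det_of_mem_unitaryGroup {U : Matrix n n ℂ} (hU : U ∈ Matrix.unitaryGroup n ℂ) :
    ‖U.det‖ = 1 :=
  CStarRing.norm_of_mem_unitary (Matrix.det_of_mem_unitary hU)

/-- If one product Kraus operator `A ⊗ Bᵀ` clones, up to a factor, the maximally entangled states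
with matrices `U₀` and `U`, then `U * U₀ᴴ` belongs to the cloning group of `A` up to a phase. The
blank state and the operator on the other side cancel. -/
theorem exists_smul_mem_cloningGroup [Nonempty n] {A B : Matrix (n × n) (n × n) ℂ}
    {X U₀ U : Matrix n n ℂ} (hU₀ : U₀ ∈ Matrix.unitaryGroup n ℂ)
    (hU : U ∈ Matrix.unitaryGroup n ℂ) {c₀ c : ℂ} (hc₀ : c₀ ≠ 0)
    (h₀ : A * (U₀ ⊗ₖ X) * B = c₀ • (U₀ ⊗ₖ U₀)) (h : A * (U ⊗ₖ X) * B = c • (U ⊗ₖ U)) :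
    IsUnit A.det ∧ ∃ e : ℂ, ‖e‖ = 1 ∧ ∃ T ∈ cloningGroup A, (T : Matrix n n ℂ) = e • (U * U₀ᴴ) := by
  have hUU : U₀ᴴ * U₀ = 1 := Matrix.mem_unitaryGroup_iff'.1 hU₀
  have hT : U * U₀ᴴ ∈ Matrix.unitaryGroup n ℂ := mul_mem hU (Unitary.star_mem hU₀)
  have hUT : U = (U * U₀ᴴ) * U₀ := by rw [Matrix.mul_assoc, hUU, Matrix.mul_one]
  generalize U * U₀ᴴ = T at *
  set R := (U₀ ⊗ₖ X) * B with hR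
  have hdet : A.det * R.det ≠ 0 := by
    rw [← Matrix.det_mul, hR, ← Matrix.mul_assoc, h₀, Matrix.det_smul, Matrix.det_kronecker]
    have : U₀.det ≠ 0 := by
      rw [← norm_ne_zero_iff, norm_det_of_mem_unitaryGroup hU₀]
      exact one_ne_zero
    exact mul_ne_zero (pow_ne_zero _ hc₀) (mul_ne_zero (pow_ne_zero _ this) (pow_ne_zero _ this))
  have hAd := left_ne_zero_of_mul hdet
  have hRu : IsUnit R.det := (right_ne_zero_of_mul hdet).isUnit
  have key : A * (T ⊗ₖ (1 : Matrix n n ℂ)) = (c * c₀⁻¹) • ((T ⊗ₖ T) * A) := by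
    have h1 : A * (T ⊗ₖ (1 : Matrix n n ℂ)) * R = (c * c₀⁻¹) • ((T ⊗ₖ T) * A) * R := by
      calc A * (T ⊗ₖ (1 : Matrix n n ℂ)) * R = A * (U ⊗ₖ X) * B := by
            rw [hR, Matrix.mul_assoc, ← Matrix.mul_assoc (T ⊗ₖ (1 : Matrix n n ℂ)),
              ← Matrix.mul_kronecker_mul, ← hUT, Matrix.one_mul, Matrix.mul_assoc]
        _ = c • ((T ⊗ₖ T) * (c₀⁻¹ • (A * (U₀ ⊗ₖ X) * B))) := by
            rw [h, h₀, smul_smul, inv_mul_cancel₀ hc₀, one_smul, ← Matrix.mul_kronecker_mul, ← hUT]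
        _ = _ := by
            rw [hR, Matrix.mul_smul, smul_smul, Matrix.smul_mul]
            simp only [Matrix.mul_assoc]
    have h2 := congrArg (· * R⁻¹) h1
    simpa only [Matrix.mul_assoc, Matrix.mul_nonsing_inv _ hRu, Matrix.mul_one,
      Matrix.smul_mul] using h2
  have hTd := norm_det_of_mem_unitaryGroup hT
  -- determinants have modulus one, which fixes the modulus of the factor
  have he : ‖c * c₀⁻¹‖ = 1 := by
    have h1 := congrArg (fun M => ‖M.det‖) key
    simp only [Matrix.det_mul, Matrix.det_smul, Matrix.det_kronecker, norm_mul (_ ^ _),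
      norm_mul (Matrix.det _), norm_mul (_ * _), norm_pow, hTd, one_pow, Matrix.det_one,
      one_mul, mul_one] at h1
    have h3 := mul_right_cancel₀ (norm_ne_zero_iff.2 hAd) ((one_mul _).trans h1)
    exact (pow_eq_one_iff_of_nonneg (norm_nonneg _) Fintype.card_ne_zero).1 h3.symm
  generalize c * c₀⁻¹ = e at *
  refine ⟨hAd.isUnit, e, he, ⟨e • T, ?_⟩, ?_, rfl⟩
  · rw [Matrix.mem_unitaryGroup_iff, star_smul, smul_mul_smul_comm,
      Matrix.mem_unitaryGroup_iff.1 hT]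
    have : e * star e = 1 := by
      rw [Complex.star_def, Complex.mul_conj', he]; simp
    rw [this, one_smul]
  · change A * ((e • T) ⊗ₖ (1 : Matrix n n ℂ)) = ((e • T) ⊗ₖ (e • T)) * A
    simp only [Matrix.smul_kronecker, Matrix.kronecker_smul, Matrix.mul_smul, Matrix.smul_mul, key]
end

theorem isGroupShiftedA_empty {D : ℕ} (hD : 1 ≤ D) :
    IsGroupShiftedA (∅ : Set (EuclideanSpace ℂ (Fin D × Fin D))) := by
  have : NeZero D := ⟨by omega⟩
  -- any group of order `D` will do
  let e : Fin D ≃ Multiplicative (ZMod D) := Fintype.equivOfCardEq (by simp)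
  let u := (EuclideanSpace.basisFun (Fin D) ℂ).reindex e
  exact ⟨Multiplicative (ZMod D), inferInstance, inferInstance, u, u, by simp⟩

theorem ketBra_eq_zero_iff {ι : Type} {x : EuclideanSpace ℂ ι} : ketBra x = 0 ↔ x = 0 := by
  constructor
  · intro h
    ext i
    simpa [ketBra] using congrFun (congrFun h i) i
  · rintro rfl
    ext i j
    simp [ketBra]

/-- Relative to a fixed state `ψ₀` with matrix `U₀ / √D`, every cloned state has, up to a phase, the
matrix `T * U₀ / √D` with `T` in the cloning group of one Kraus operator of Alice. In the basis
`W` in which this group acts by left translations of `G`, the second basis absorbs `Wᴴ * U₀`. -/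
theorem CanBeClonedByLOCC.isGroupShiftedA {D : ℕ} (hD : 1 ≤ D)
    {S : Set (EuclideanSpace ℂ (Fin D × Fin D))} (hS : ∀ ψ ∈ S, IsMaximallyEntangled ψ)
    (h : CanBeClonedByLOCC S) : IsGroupShiftedA S := by
  rcases S.eq_empty_or_nonempty with rfl | ⟨ψ₀, hψ₀⟩
  · exact isGroupShiftedA_empty hD
  have : NeZero D := ⟨by omega⟩
  obtain ⟨φ, -, Λ, hΛ, hclone⟩ := h
  obtain ⟨ι, _, A, B, hAB⟩ := hΛ.exists_kraus
  have hsum : ∀ ψ ∈ S, ∑ i, ketBra (WithLp.toLp 2 ((A i ⊗ₖ B i) *ᵥ twoPairs ψ φ)) =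
      ketBra (twoPairs ψ ψ) := by
    intro ψ hψ
    rw [← hclone ψ hψ, hAB]
    exact Finset.sum_congr rfl fun i _ => (mul_ketBra_mul_conjTranspose _ _).symm
  have hs : ((Real.sqrt D : ℝ) : ℂ)⁻¹ ≠ 0 := by
    simp [NeZero.ne D]
  obtain ⟨U₀, hU₀, hψU₀⟩ := (hS ψ₀ hψ₀).exists_unitary
  -- some Kraus operator does not annihilate the first state
  obtain ⟨i, hi⟩ : ∃ i, (WithLp.toLp 2 ((A i ⊗ₖ B i) *ᵥ twoPairs ψ₀ φ) :
      EuclideanSpace ℂ ((Fin D × Fin D) × (Fin D × Fin D))) ≠ 0 := by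
    by_contra hcon
    push Not at hcon
    have h0 := hsum ψ₀ hψ₀
    simp only [hcon, ketBra_eq_zero_iff.2, Finset.sum_const_zero] at h0
    have h1 := congrArg coeffMatrix (ketBra_eq_zero_iff.1 h0.symm)
    rw [coeffMatrix_twoPairs, hψU₀] at h1
    have h2 := congrArg Matrix.det h1
    have h3 : U₀.det ≠ 0 := by
      rw [← norm_ne_zero_iff, norm_det_of_mem_unitaryGroup hU₀]
      exact one_ne_zero
    have h4 : (coeffMatrix (0 : EuclideanSpace ℂ ((Fin D × Fin D) × (Fin D × Fin D)))).det = 0 :=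
      Matrix.det_zero
    rw [h4, Matrix.det_kronecker, Matrix.det_smul] at h2
    exact mul_ne_zero (pow_ne_zero _ (mul_ne_zero (pow_ne_zero _ hs) h3))
      (pow_ne_zero _ (mul_ne_zero (pow_ne_zero _ hs) h3)) h2
  have hmat : ∀ ψ ∈ S, ∀ U, coeffMatrix ψ = ((Real.sqrt D : ℝ) : ℂ)⁻¹ • U →
      ∃ c : ℂ, A i * (U ⊗ₖ coeffMatrix φ) * (B i)ᵀ =
          (c * ((Real.sqrt D : ℝ) : ℂ)⁻¹) • (U ⊗ₖ U) ∧
        (WithLp.toLp 2 ((A i ⊗ₖ B i) *ᵥ twoPairs ψ φ) :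
          EuclideanSpace ℂ ((Fin D × Fin D) × (Fin D × Fin D))) =
            c • twoPairs ψ ψ := by
    intro ψ hψ U hU
    obtain ⟨c, hc⟩ := exists_smul_of_sum_ketBra_eq (hsum ψ hψ) i
    refine ⟨c, ?_, hc⟩
    have h1 := congrArg coeffMatrix hc
    rw [coeffMatrix_kronecker_mulVec, coeffMatrix_smul, coeffMatrix_twoPairs,
      coeffMatrix_twoPairs, hU, Matrix.smul_kronecker, Matrix.mul_smul, Matrix.smul_mul,
      Matrix.smul_kronecker, smul_comm c] at h1
    rw [smul_right_injective _ hs h1, Matrix.kronecker_smul, smul_smul]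
  obtain ⟨c₀, hc₀, hc₀'⟩ := hmat ψ₀ hψ₀ U₀ hψU₀
  have hc₀0 : c₀ * ((Real.sqrt D : ℝ) : ℂ)⁻¹ ≠ 0 := by
    refine mul_ne_zero ?_ hs
    rintro rfl
    rw [zero_smul] at hc₀'
    exact hi hc₀'
  have hdet : IsUnit (A i).det := (exists_smul_mem_cloningGroup hU₀ hU₀ hc₀0 hc₀ hc₀).1
  obtain ⟨G, _, _, _, j, W, hW1, hW2, hWj⟩ := exists_leftRegular_of_trace_eq_zero
    (cloningGroup (A i)) (fun T hT hT1 => trace_eq_zero_of_mem_cloningGroup hdet hT hT1)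
  have hU1 : U₀ᴴ * U₀ = 1 := Matrix.mem_unitaryGroup_iff'.1 hU₀
  have hU2 : U₀ * U₀ᴴ = 1 := Matrix.mem_unitaryGroup_iff.1 hU₀
  have hM1 : (Wᴴ * U₀) * (Wᴴ * U₀)ᴴ = 1 := by
    rw [Matrix.conjTranspose_mul, Matrix.conjTranspose_conjTranspose, Matrix.mul_assoc,
      ← Matrix.mul_assoc U₀, hU2, Matrix.one_mul, hW1]
  have hM2 : (Wᴴ * U₀)ᴴ * (Wᴴ * U₀) = 1 := by
    rw [Matrix.conjTranspose_mul, Matrix.conjTranspose_conjTranspose, Matrix.mul_assoc,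
      ← Matrix.mul_assoc W, hW2, Matrix.one_mul, hU1]
  obtain ⟨u, hu⟩ := exists_columnMatrix_eq hW1 hW2
  obtain ⟨v, hv⟩ := exists_columnMatrix_eq (W := (Wᴴ * U₀)ᵀ)
    (by rw [Matrix.transpose_conjTranspose_comm, ← Matrix.transpose_mul, hM1,
      Matrix.transpose_one])
    (by rw [Matrix.transpose_conjTranspose_comm, ← Matrix.transpose_mul, hM2,
      Matrix.transpose_one])
  refine ⟨G, inferInstance, inferInstance, u, v, fun ψ hψ => ?_⟩
  obtain ⟨U, hU, hψU⟩ := (hS ψ hψ).exists_unitary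
  obtain ⟨c, hc, -⟩ := hmat ψ hψ U hψU
  obtain ⟨-, e, he, T, hT, hTe⟩ := exists_smul_mem_cloningGroup hU₀ hU hc₀0 hc₀ hc
  have he0 : e ≠ 0 := norm_ne_zero_iff.1 (by rw [he]; exact one_ne_zero)
  refine ⟨j ⟨T, hT⟩, e⁻¹, by rw [norm_inv, he, inv_one], coeffMatrix_injective ?_⟩
  rw [coeffMatrix_smul, coeffMatrix_groupShiftA, hu, hv, Matrix.transpose_transpose, hψU,
    smul_comm e⁻¹, ← hWj ⟨T, hT⟩]
  congr 1
  rw [Matrix.mul_assoc, ← Matrix.mul_assoc W, hW2, Matrix.one_mul, hTe, Matrix.smul_mul, smul_smul,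
    inv_mul_cancel₀ he0, one_smul, Matrix.mul_assoc, hU1, Matrix.mul_one]

/-! ### Cloning by controlled group translations -/

/-- The permutation matrix of `|x⟩|y⟩ ↦ |x⟩|xy⟩`. -/
def controlledShift (G : Type*) [Group G] [DecidableEq G] : Matrix (G × G) (G × G) ℂ :=
  Matrix.of fun a b => if a = (b.1, b.1 * b.2) then 1 else 0

section
variable {G : Type*} [Group G] [Fintype G] [DecidableEq G]

theorem mul_controlledShift_apply {m : Type*} (M : Matrix m (G × G) ℂ) (i : m) (b : G × G) :
    (M * controlledShift G) i b = M i (b.1, b.1 * b.2) := by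
  simp [Matrix.mul_apply, controlledShift]

theorem conjTranspose_controlledShift_mul_self :
    (controlledShift G)ᴴ * controlledShift G = 1 := by
  ext a b
  rw [mul_controlledShift_apply, Matrix.conjTranspose_apply]
  simp only [controlledShift, Matrix.of_apply, Matrix.one_apply, Prod.ext_iff, apply_ite star,
    star_one, star_zero]
  congr 1
  rw [eq_iff_iff]
  constructor
  · rintro ⟨h1, h2⟩
    rw [h1] at h2
    exact ⟨h1.symm, (mul_left_cancel h2).symm⟩
  · rintro ⟨h1, h2⟩
    simp [h1, h2]

theorem controlledShift_mul_transpose_self :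
    controlledShift G * (controlledShift G)ᵀ = 1 := by
  have h : (controlledShift G)ᴴ = (controlledShift G)ᵀ := by
    ext a b
    simp [controlledShift, apply_ite]
  rw [← h]
  exact mul_eq_one_comm.1 conjTranspose_controlledShift_mul_self

theorem controlledShift_mul_leftRegularMatrix_kronecker_one (f : G) :
    controlledShift G * (leftRegularMatrix G f ⊗ₖ (1 : Matrix G G ℂ)) =
      (leftRegularMatrix G f ⊗ₖ leftRegularMatrix G f) * controlledShift G := by
  ext a b
  rw [mul_controlledShift_apply, Matrix.mul_apply, Finset.sum_eq_single (f * b.1, b.2)]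
  · simp only [controlledShift, Matrix.of_apply, Matrix.kroneckerMap_apply, leftRegularMatrix_apply,
      Prod.ext_iff, Matrix.one_apply_eq, if_true, mul_one, mul_assoc, ite_and]
    split_ifs <;> simp
  · rintro ⟨c, d⟩ - hcd
    rw [Matrix.kroneckerMap_apply, leftRegularMatrix_apply, Matrix.one_apply]
    by_cases h1 : c = f * b.1
    · have h2 : d ≠ b.2 := fun h2 => hcd (by rw [h1, h2])
      simp [h2]
    · simp [h1]
  · simp

/-- The operation `|x⟩|y⟩ ↦ |x⟩|xy⟩` in the basis formed by the columns of `W`. -/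
def labelledControlledShift {m : Type*} (W : Matrix m G ℂ) : Matrix (m × m) (m × m) ℂ :=
  (W ⊗ₖ W) * controlledShift G * (W ⊗ₖ W)ᴴ

variable {m m' : Type*} [Fintype m] [Fintype m']

theorem conjTranspose_labelledControlledShift_mul_self [DecidableEq m] {W : Matrix m G ℂ}
    (h1 : Wᴴ * W = 1) (h2 : W * Wᴴ = 1) :
    (labelledControlledShift W)ᴴ * labelledControlledShift W = 1 := by
  have e1 : (W ⊗ₖ W)ᴴ * (W ⊗ₖ W) = 1 := by
    rw [Matrix.conjTranspose_kronecker, ← Matrix.mul_kronecker_mul, h1, Matrix.one_kronecker_one]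
  have e2 : (W ⊗ₖ W) * (W ⊗ₖ W)ᴴ = 1 := by
    rw [Matrix.conjTranspose_kronecker, ← Matrix.mul_kronecker_mul, h2, Matrix.one_kronecker_one]
  rw [labelledControlledShift, Matrix.conjTranspose_mul, Matrix.conjTranspose_mul,
    Matrix.conjTranspose_conjTranspose]
  generalize W ⊗ₖ W = Y at *
  calc Y * ((controlledShift G)ᴴ * Yᴴ) * (Y * controlledShift G * Yᴴ)
      = Y * ((controlledShift G)ᴴ * (Yᴴ * Y) * controlledShift G) * Yᴴ := by
        simp only [Matrix.mul_assoc]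
    _ = 1 := by
        rw [e1, Matrix.mul_one, conjTranspose_controlledShift_mul_self, Matrix.mul_one, e2]

/-- The controlled translations of both parties turn `ψ_f ⊗ ψ_1` into `ψ_f ⊗ ψ_f`. -/
theorem labelledControlledShift_mul_kronecker_mul_transpose {W : Matrix m G ℂ} {V : Matrix m' G ℂ}
    (hW : Wᴴ * W = 1) (hV : Vᴴ * V = 1) (f : G) :
    labelledControlledShift W * ((W * leftRegularMatrix G f * Vᵀ) ⊗ₖ
      (W * leftRegularMatrix G 1 * Vᵀ)) * (labelledControlledShift V)ᵀ =
      (W * leftRegularMatrix G f * Vᵀ) ⊗ₖ (W * leftRegularMatrix G f * Vᵀ) := by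
  have e1 : (W ⊗ₖ W)ᴴ * (W ⊗ₖ W) = 1 := by
    rw [Matrix.conjTranspose_kronecker, ← Matrix.mul_kronecker_mul, hW, Matrix.one_kronecker_one]
  have e2 : (V ⊗ₖ V)ᵀ * ((V ⊗ₖ V)ᴴ)ᵀ = 1 := by
    rw [← Matrix.transpose_mul, Matrix.conjTranspose_kronecker, ← Matrix.mul_kronecker_mul, hV,
      Matrix.one_kronecker_one, Matrix.transpose_one]
  have e3 : Vᵀ ⊗ₖ Vᵀ = (V ⊗ₖ V)ᵀ := rfl
  rw [labelledControlledShift, labelledControlledShift, Matrix.mul_kronecker_mul,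
    Matrix.mul_kronecker_mul, Matrix.mul_kronecker_mul, Matrix.mul_kronecker_mul, e3, map_one,
    Matrix.transpose_mul, Matrix.transpose_mul]
  generalize W ⊗ₖ W = Y at *
  generalize V ⊗ₖ V = Z at *
  set L := leftRegularMatrix G f
  calc Y * controlledShift G * Yᴴ * (Y * (L ⊗ₖ (1 : Matrix G G ℂ)) * Zᵀ) *
        (Zᴴᵀ * ((controlledShift G)ᵀ * Zᵀ))
      = Y * (controlledShift G * (Yᴴ * Y) * (L ⊗ₖ (1 : Matrix G G ℂ)) * (Zᵀ * Zᴴᵀ) *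
          (controlledShift G)ᵀ) * Zᵀ := by
        simp only [Matrix.mul_assoc]
    _ = Y * (L ⊗ₖ L) * Zᵀ := by
        rw [e1, e2, Matrix.mul_one, Matrix.mul_one,
          controlledShift_mul_leftRegularMatrix_kronecker_one, Matrix.mul_assoc (_ ⊗ₖ _),
          controlledShift_mul_transpose_self, Matrix.mul_one]
end

theorem ketBra_smul {ι : Type} {c : ℂ} (hc : ‖c‖ = 1) (x : EuclideanSpace ℂ ι) :
    ketBra (c • x) = ketBra x := by
  ext i j
  have : c * star c = 1 := by
    rw [Complex.star_def, Complex.mul_conj', hc]; simp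
  simp only [ketBra, Matrix.of_apply, PiLp.smul_apply, smul_eq_mul, star_mul']
  linear_combination (x i * star (x j)) * this

theorem norm_groupShiftA {D : ℕ} (hD : 1 ≤ D) {G : Type} [Group G] [Fintype G]
    (u v : OrthonormalBasis G ℂ (EuclideanSpace ℂ (Fin D))) (f : G) :
    ‖groupShiftA u v f‖ = 1 := by
  classical
  have hn : ∀ ψ : EuclideanSpace ℂ (Fin D × Fin D),
      ((‖ψ‖ ^ 2 : ℝ) : ℂ) = (coeffMatrix ψ * (coeffMatrix ψ)ᴴ).trace := by
    intro ψ
    rw [EuclideanSpace.norm_sq_eq, Fintype.sum_prod_type]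
    simp [Matrix.trace, Matrix.mul_apply, coeffMatrix, Complex.mul_conj']
  have hu := conjTranspose_columnMatrix_mul_self u
  have hv := conjTranspose_columnMatrix_mul_self v
  have hu' := columnMatrix_mul_conjTranspose_self u
  have hL : leftRegularMatrix G f * leftRegularMatrix G f⁻¹ = 1 := by
    rw [← map_mul, mul_inv_cancel, map_one]
  have hv' : (columnMatrix v)ᵀ * ((columnMatrix v)ᵀ)ᴴ = 1 := by
    rw [Matrix.transpose_conjTranspose_comm, ← Matrix.transpose_mul, hv, Matrix.transpose_one]
  have h1 : ((‖groupShiftA u v f‖ ^ 2 : ℝ) : ℂ) = 1 := by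
    rw [hn, coeffMatrix_groupShiftA, Matrix.conjTranspose_smul, Matrix.smul_mul, Matrix.mul_smul,
      Matrix.conjTranspose_mul, Matrix.mul_assoc, ← Matrix.mul_assoc (columnMatrix v)ᵀ, hv',
      Matrix.one_mul, Matrix.conjTranspose_mul, conjTranspose_leftRegularMatrix, Matrix.mul_assoc,
      ← Matrix.mul_assoc (leftRegularMatrix G f), hL, Matrix.one_mul, hu', smul_smul,
      Matrix.trace_smul, Matrix.trace_one, Fintype.card_fin, smul_eq_mul]
    have hD0 : (D : ℝ) ≠ 0 := by positivity
    have hD1 : ((√(D : ℝ))⁻¹ * (√(D : ℝ))⁻¹) * D = 1 := by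
      rw [← mul_inv, Real.mul_self_sqrt (by positivity), inv_mul_cancel₀ hD0]
    rw [star_inv₀, Complex.star_def, Complex.conj_ofReal]
    exact_mod_cast hD1
  have h2 : ‖groupShiftA u v f‖ ^ 2 = 1 := by exact_mod_cast h1
  exact (pow_eq_one_iff_of_nonneg (norm_nonneg _) two_ne_zero).1 h2

/-- The blank state is `ψ_1`, and both parties apply `|x⟩|y⟩ ↦ |x⟩|xy⟩`. -/
theorem IsGroupShiftedA.canBeClonedByLOCC {D : ℕ} (hD : 1 ≤ D)
    {S : Set (EuclideanSpace ℂ (Fin D × Fin D))} (h : IsGroupShiftedA S) :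
    CanBeClonedByLOCC S := by
  classical
  obtain ⟨G, _, _, u, v, hS⟩ := h
  have hN : ∀ w : OrthonormalBasis G ℂ (EuclideanSpace ℂ (Fin D)),
      ∑ _k : Fin 1, (labelledControlledShift (columnMatrix w))ᴴ *
        labelledControlledShift (columnMatrix w) = 1 := by
    intro w
    rw [Fin.sum_univ_one, conjTranspose_labelledControlledShift_mul_self
      (conjTranspose_columnMatrix_mul_self w) (columnMatrix_mul_conjTranspose_self w)]
  refine ⟨groupShiftA u v 1, norm_groupShiftA hD u v 1, _,
    IsLOCC.alice _ _ 1 (fun _ => Fin D × Fin D)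
      (fun _ => labelledControlledShift (columnMatrix u)) (hN u) _
      fun _ => IsLOCC.bob _ _ 1 (fun _ => Fin D × Fin D)
        (fun _ => labelledControlledShift (columnMatrix v)) (hN v) _
        fun _ => IsLOCC.finish, fun ψ hψ => ?_⟩
  obtain ⟨f, c, hc, rfl⟩ := hS ψ hψ
  have hc0 : c ≠ 0 := norm_ne_zero_iff.1 (by rw [hc]; exact one_ne_zero)
  simp only [Finset.univ_unique, Finset.sum_singleton]
  rw [mul_ketBra_mul_conjTranspose, mul_ketBra_mul_conjTranspose,
    ← ketBra_smul (c := c⁻¹) (by rw [norm_inv, hc, inv_one]) (twoPairs (c • _) _)]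
  congr 1
  apply coeffMatrix_injective
  rw [coeffMatrix_kronecker_mulVec, coeffMatrix_kronecker_mulVec, Matrix.transpose_one,
    Matrix.mul_one, Matrix.one_mul, coeffMatrix_smul, coeffMatrix_twoPairs, coeffMatrix_twoPairs,
    coeffMatrix_smul, coeffMatrix_groupShiftA, coeffMatrix_groupShiftA]
  simp only [Matrix.smul_kronecker, Matrix.kronecker_smul, Matrix.mul_smul, Matrix.smul_mul,
    labelledControlledShift_mul_kronecker_mul_transpose (conjTranspose_columnMatrix_mul_self u)
      (conjTranspose_columnMatrix_mul_self v), smul_smul]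
  congr 1
  field_simp

theorem mainTheorem5 (D : ℕ) (hD : 1 ≤ D) (S : Set (EuclideanSpace ℂ (Fin D × Fin D)))
    (hS : ∀ ψ ∈ S, IsMaximallyEntangled ψ) :
    (CanBeClonedByLOCC S ↔ IsGroupShiftedA S) ∧ (CanBeClonedByLOCC S ↔ IsGroupShiftedB S) := by
  have h : CanBeClonedByLOCC S ↔ IsGroupShiftedA S :=
    ⟨fun h => h.isGroupShiftedA hD hS, fun h => h.canBeClonedByLOCC hD⟩
  exact ⟨h, h.trans (isGroupShiftedA_iff_isGroupShiftedB S)⟩
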